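/- Consider bond percolation on $\mathbb{Z}^d$: every nearest-neighbor edge is open with probability $p$ and closed with probability $1-p$, independently, and $\mathbb{P}_p$ is the resulting product measure. A vertex is shielded if all edges incident to it are closed, and a shielded path is a path (with distinct vertices) all of whose vertices are shielded. Let \[ p_{shield}(d) = \sup\{p\in[0,1] : \mathbb{P}_p(\text{there exists an infinite shielded path})>0\}. \] Let $X_1,X_1',X_2,X_2',\dots$ be i.i.d. and uniform on the standard basis vectors $\mathbf{e}_1,\dots,\mathbf{e}_d$ of $\mathbb{Z}^d$, let $S_n = X_1+\dots+X_n$, $S_n' = X_1'+\dots+X_n'$, and let \[ p_2 = p_2(d) = \mathbb{P}\left(\|S_n-S_n'\|_1 = 2 \text{ for some } n\geq 2 \,\middle|\, \|S_1-S_1'\|_1 = 2\right). \] Theorem. Suppose that $d\geq 4$ and that the real number $p$ satisfies \[ p < 1-\left(\frac1d\right)^{\frac{1}{2d-1}} \quad\text{and}\quad \frac{1}{1-p}\left(p_2-\frac{1}{d^2}+\frac1d\left(1-\frac1d\right)\left(d(1-p)^{2d-1}-1\right)^{-1}\right)<1 . \] Then $p_{shield}(d)\geq p$. -/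

import Mathlib

open MeasureTheory ProbabilityTheory

noncomputable section

namespace ShieldedPercolation

/-- The `ℓ¹` norm on `ℤ^d`. -/
def l1norm {d : ℕ} (x : Fin d → ℤ) : ℤ := ∑ i, |x i|

/-- The nearest-neighbour graph on `ℤ^d`. -/
def latticeGraph (d : ℕ) : SimpleGraph (Fin d → ℤ) where
  Adj x y := l1norm (x - y) = 1
  symm := ⟨fun x y h => by
    simpa only [l1norm, Pi.sub_apply, abs_sub_comm] using h⟩
  loopless := ⟨fun x h => by simp [l1norm] at h⟩

/-- Bond configurations on `ℤ^d`: `ω e = true` means that the edge `e` is open, and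
`ω e = false` that it is closed. -/
abbrev Config (d : ℕ) : Type := (latticeGraph d).edgeSet → Bool

/-- The law of bond percolation on `ℤ^d`: the product measure under which every edge is open with
probability `p` and closed with probability `1 - p`, independently. -/
def percolationMeasure (d : ℕ) (p : unitInterval) : Measure (Config d) :=
  Measure.infinitePi fun _ => bernoulliMeasure true false p

/-- A vertex is shielded if all the edges incident to it are closed. -/
def IsShielded {d : ℕ} (ω : Config d) (x : Fin d → ℤ) : Prop :=
  ∀ e : (latticeGraph d).edgeSet, x ∈ (e : Sym2 (Fin d → ℤ)) → ω e = false

/-- There is an infinite shielded path: an infinite nearest-neighbour path with pairwise distinct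
vertices, all of them shielded. -/
def HasInfiniteShieldedPath {d : ℕ} (ω : Config d) : Prop :=
  ∃ γ : ℕ → Fin d → ℤ, Function.Injective γ ∧
    (∀ n, (latticeGraph d).Adj (γ n) (γ (n + 1))) ∧ ∀ n, IsShielded ω (γ n)

/-- The shielded critical probability, the supremum of the `p ∈ [0, 1]` for which an infinite
shielded path exists with positive probability. -/
def pShield (d : ℕ) : ℝ :=
  sSup {p : ℝ | ∃ hp : p ∈ unitInterval,
    0 < percolationMeasure d ⟨p, hp⟩ {ω | HasInfiniteShieldedPath ω}}

/-- The steps of two oriented walks: `ω n = (i, j)` means that the `(n+1)`-st steps of the first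
and of the second walk are the standard basis vectors with indices `i` and `j`. -/
abbrev Steps (d : ℕ) : Type := ℕ → Fin d × Fin d

/-- All the steps of both walks are independent and uniform over the standard basis vectors. -/
def walkMeasure (d : ℕ) : Measure (Steps d) :=
  Measure.infinitePi fun _ => (uniformOn Set.univ).prod (uniformOn Set.univ)

/-- The position of the first walk after `n` steps. -/
def walk {d : ℕ} (ω : Steps d) (n : ℕ) : Fin d → ℤ :=
  ∑ k ∈ Finset.range n, Pi.single (ω k).1 1

/-- The position of the second walk after `n` steps. -/
def walk' {d : ℕ} (ω : Steps d) (n : ℕ) : Fin d → ℤ :=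
  ∑ k ∈ Finset.range n, Pi.single (ω k).2 1

/-- The conditional probability, given that the two walks are at `ℓ¹` distance `2` after one step,
that they are at `ℓ¹` distance `2` after `n` steps for some `n ≥ 2`. -/
def p₂ (d : ℕ) : ℝ :=
  (cond (walkMeasure d) {ω | l1norm (walk ω 1 - walk' ω 1) = 2}).real
    {ω | ∃ n : ℕ, 2 ≤ n ∧ l1norm (walk ω n - walk' ω n) = 2}

end ShieldedPercolation

end

/-!
The proof is the second moment method for oriented paths, that is paths whose steps are standard
basis vectors. Call such a path closed if all edges incident to it are closed, counting only those
between the levels of its endpoints, and give each oriented path of length `n` from the origin the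
weight `𝟙(closed) / ℙ(closed)`. The sum of the weights has mean `d ^ n`, and its second moment is
the sum over pairs of paths of `r ^ N`, where `r = 1 / (1 - p)` and `N` is the number of these
edges that the two paths share. If the second moment is at most `C * d ^ (2 * n)` with `C`
independent of `n`, the Cauchy–Schwarz inequality (`sq_sum_measureReal_le`) gives a closed
oriented path of length `n` with probability at least `1 / C`. By compactness
(`exists_forall_closed`) an infinite one then exists with probability at least `1 / C`, and it is
shielded from its second vertex on.

To bound the second moment, follow the difference `D` of the two paths, a Markov chain. The shared
edges can be counted level by level (`card_inter_pathEdges_succ_le`). Between two consecutive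
levels there are at most `2 * d - 1` of them if the paths stay together, `d` if they separate or
meet, one if `D = e_a - e_b` with `a ≠ b` and just one path steps to a neighbour of the current
vertex of the other, and none otherwise. With `u D` the probability that the unweighted chain from
`D` visits distance `2`, the function equal to `H` at `D = 0` and to `1 + c * u D` elsewhere is
superharmonic for the weighted chain (`sum_pow_mul_potential_le`) as soon as one inequality holds
at the origin and one at the points `e_a - e_b`; elsewhere this is the superharmonicity of `u`. By
symmetry of the coordinates the mean of `u` one step after `e_a - e_b` is `p₂`
(`sum_hitProb_stepDiff`). The first assumption on `p` makes the geometric series for the time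
spent together converge, so that `H` exists, and the second one then leaves room for `c`
(`exists_potential_constants`). Hence the second moment is at most `H * d ^ (2 * n)`.
-/

namespace ShieldedPercolation

variable {d : ℕ}

/-! ### The Markov property of the pair of walks -/

/-- The increment of the difference of the two walks caused by the pair of steps `s`. -/
def stepDiff (s : Fin d × Fin d) : Fin d → ℤ := Pi.single s.1 1 - Pi.single s.2 1

/-- The pair of walks whose first pair of steps is `s` and which then follows `ω`. -/
def consStep (s : Fin d × Fin d) (ω : Steps d) : Steps d
  | 0 => s
  | n + 1 => ω n

lemma measurable_consStep (s : Fin d × Fin d) : Measurable (consStep s) := by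
  refine measurable_pi_iff.2 fun n => ?_
  cases n with
  | zero => exact measurable_const
  | succ n => exact measurable_pi_apply n

lemma walk_sub_consStep_succ (s : Fin d × Fin d) (ω : Steps d) (n : ℕ) :
    walk (consStep s ω) (n + 1) - walk' (consStep s ω) (n + 1) =
      stepDiff s + (walk ω n - walk' ω n) := by
  simp only [walk, walk', Finset.sum_range_succ', consStep, stepDiff]
  abel

lemma measurable_walk_sub (n : ℕ) : Measurable fun ω : Steps d => walk ω n - walk' ω n := by
  have h (f : Fin d × Fin d → Fin d → ℤ) :
      Measurable fun ω : Steps d => ∑ k ∈ Finset.range n, f (ω k) :=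
    Finset.measurable_sum _ fun k _ => (measurable_of_countable f).comp (measurable_pi_apply k)
  exact (h fun s => Pi.single s.1 1).sub (h fun s => Pi.single s.2 1)

lemma measurableSet_l1norm_walk_sub (D : Fin d → ℤ) (n : ℕ) :
    MeasurableSet {ω : Steps d | l1norm (D + (walk ω n - walk' ω n)) = 2} :=
  (measurable_walk_sub n) (Set.to_countable {x | l1norm (D + x) = 2}).measurableSet

/-- The law of one pair of steps. -/
noncomputable abbrev stepLaw (d : ℕ) : Measure (Fin d × Fin d) :=
  (uniformOn Set.univ).prod (uniformOn Set.univ)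

instance [NeZero d] : IsProbabilityMeasure (uniformOn (Set.univ : Set (Fin d))) :=
  isProbabilityMeasure_uniformOn Set.finite_univ Set.univ_nonempty

instance [NeZero d] : IsProbabilityMeasure (walkMeasure d) := by
  unfold walkMeasure; infer_instance

lemma stepLaw_singleton (s : Fin d × Fin d) : stepLaw d {s} = ((d : ENNReal) ^ 2)⁻¹ := by
  have h (i : Fin d) : uniformOn (Set.univ : Set (Fin d)) {i} = (d : ENNReal)⁻¹ := by
    rw [uniformOn_univ]; simp
  rw [← Prod.mk.eta (p := s), ← Set.singleton_prod_singleton, Measure.prod_prod, h, h, sq,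
    ENNReal.mul_inv] <;> simp

lemma stepLaw_apply [NeZero d] (t : Set (Fin d × Fin d)) [DecidablePred (· ∈ t)] :
    stepLaw d t = ∑ s, if s ∈ t then ((d : ENNReal) ^ 2)⁻¹ else 0 := by
  have h : ((Finset.univ.filter (· ∈ t) : Finset (Fin d × Fin d)) : Set (Fin d × Fin d)) = t := by
    ext; simp
  have h' := sum_measure_singleton (μ := stepLaw d) (s := Finset.univ.filter (· ∈ t))
  rw [h] at h'
  rw [← h', ← Finset.sum_filter]
  exact Finset.sum_congr rfl fun s _ => stepLaw_singleton s

/-- Conditioning on the first pair of steps. -/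
lemma walkMeasure_eq_sum [NeZero d] :
    walkMeasure d = ∑ s, ((d : ENNReal) ^ 2)⁻¹ • (walkMeasure d).map (consStep s) := by
  classical
  symm
  refine Measure.eq_infinitePi _ fun I t ht => ?_
  have hpre (s : Fin d × Fin d) : consStep s ⁻¹' (Set.pi I t) =
      if 0 ∈ I → s ∈ t 0 then
        Set.pi (I.preimage Nat.succ Nat.succ_injective.injOn : Finset ℕ) (fun n => t (n + 1))
      else ∅ := by
    ext ω
    split_ifs with h
    · simp only [Set.mem_preimage, Set.mem_pi, Finset.mem_coe, Finset.mem_preimage]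
      refine ⟨fun H n hn => H (n + 1) hn, fun H n hn => ?_⟩
      cases n with
      | zero => exact h hn
      | succ n => exact H n hn
    · simp only [Set.mem_preimage, Set.mem_pi, Finset.mem_coe, Set.mem_empty_iff_false, iff_false]
      exact fun H => h fun h0 => H 0 h0
  have hprod : ∏ i ∈ I, stepLaw d (t i) = (if 0 ∈ I then stepLaw d (t 0) else 1) *
      ∏ i ∈ I.preimage Nat.succ Nat.succ_injective.injOn, stepLaw d (t (i + 1)) := by
    have h1 : ∏ i ∈ I.preimage Nat.succ Nat.succ_injective.injOn, stepLaw d (t (i + 1)) =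
        ∏ i ∈ I, if i = 0 then 1 else stepLaw d (t i) := by
      rw [← Finset.prod_preimage Nat.succ I Nat.succ_injective.injOn]
      · simp
      · intro x _ hx
        cases x with
        | zero => simp
        | succ n => exact absurd ⟨n, rfl⟩ hx
    have h2 : (if 0 ∈ I then stepLaw d (t 0) else 1) =
        ∏ i ∈ I, if i = 0 then stepLaw d (t i) else 1 := by
      rw [Finset.prod_ite_eq' I 0 fun i => stepLaw d (t i)]
    rw [h1, h2, ← Finset.prod_mul_distrib]
    exact Finset.prod_congr rfl fun i _ => by split_ifs <;> simp
  have hfirst : (∑ s : Fin d × Fin d, if 0 ∈ I → s ∈ t 0 then ((d : ENNReal) ^ 2)⁻¹ else 0) =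
      if 0 ∈ I then stepLaw d (t 0) else 1 := by
    split_ifs with h
    · simp only [h, forall_const]
      rw [stepLaw_apply]
    · have := stepLaw_apply (d := d) Set.univ
      simp only [measure_univ, Set.mem_univ, if_true] at this
      simp only [h, false_imp_iff, if_true, ← this]
  rw [show (∏ i ∈ I, ((uniformOn Set.univ).prod (uniformOn Set.univ) : Measure (Fin d × Fin d))
    (t i)) = _ from hprod, ← hfirst, Measure.finsetSum_apply, Finset.sum_mul]
  refine Finset.sum_congr rfl fun s _ => ?_
  rw [Measure.smul_apply, Measure.map_apply (measurable_consStep s)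
    (.pi I.countable_toSet fun i _ => ht i), hpre]
  split_ifs with h
  · rw [walkMeasure, Measure.infinitePi_pi _ fun i _ => ht _, smul_eq_mul]
  · simp

lemma walkMeasure_real_eq_sum [NeZero d] {A : Set (Steps d)} (hA : MeasurableSet A) :
    (walkMeasure d).real A = ((d : ℝ) ^ 2)⁻¹ * ∑ s, (walkMeasure d).real (consStep s ⁻¹' A) := by
  have h := congrArg (fun μ => μ A) (walkMeasure_eq_sum (d := d))
  simp only [Measure.finsetSum_apply, Measure.smul_apply, smul_eq_mul,
    Measure.map_apply (measurable_consStep _) hA] at h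
  rw [measureReal_def, h, ENNReal.toReal_sum, Finset.mul_sum]
  · simp [measureReal_def, ENNReal.toReal_mul, ENNReal.toReal_inv]
  · exact fun s _ => ENNReal.mul_ne_top (by simp [NeZero.ne d]) (measure_ne_top _ _)

/-! ### The hitting probability of distance two -/

/-- The probability that the difference of the two walks, started at `D`, is at some time at
`ℓ¹` distance `2` from the origin. -/
noncomputable def hitProb (D : Fin d → ℤ) : ℝ :=
  (walkMeasure d).real {ω | ∃ n, l1norm (D + (walk ω n - walk' ω n)) = 2}

lemma measurableSet_hit (D : Fin d → ℤ) :
    MeasurableSet {ω : Steps d | ∃ n, l1norm (D + (walk ω n - walk' ω n)) = 2} := by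
  rw [Set.ofPred_exists]
  exact .iUnion fun n => measurableSet_l1norm_walk_sub D n

lemma hitProb_nonneg (D : Fin d → ℤ) : 0 ≤ hitProb D := measureReal_nonneg

lemma hitProb_le_one [NeZero d] (D : Fin d → ℤ) : hitProb D ≤ 1 := measureReal_le_one

lemma hitProb_of_l1norm_eq [NeZero d] {D : Fin d → ℤ} (hD : l1norm D = 2) : hitProb D = 1 := by
  have : {ω : Steps d | ∃ n, l1norm (D + (walk ω n - walk' ω n)) = 2} = Set.univ :=
    Set.eq_univ_of_forall fun ω => ⟨0, by simpa [walk, walk'] using hD⟩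
  rw [hitProb, this, probReal_univ]

lemma measurableSet_hit_succ (D : Fin d → ℤ) :
    MeasurableSet {ω : Steps d | ∃ n, l1norm (D + (walk ω (n + 1) - walk' ω (n + 1))) = 2} := by
  rw [Set.ofPred_exists]
  exact .iUnion fun n => measurableSet_l1norm_walk_sub D (n + 1)

lemma hit_succ_eq_sum [NeZero d] (D : Fin d → ℤ) :
    (walkMeasure d).real {ω | ∃ n, l1norm (D + (walk ω (n + 1) - walk' ω (n + 1))) = 2} =
      ((d : ℝ) ^ 2)⁻¹ * ∑ s, hitProb (D + stepDiff s) := by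
  rw [walkMeasure_real_eq_sum (measurableSet_hit_succ D)]
  simp only [Set.preimage_ofPred_eq, walk_sub_consStep_succ, ← add_assoc]
  rfl

lemma hitProb_of_l1norm_ne [NeZero d] {D : Fin d → ℤ} (hD : l1norm D ≠ 2) :
    hitProb D = ((d : ℝ) ^ 2)⁻¹ * ∑ s, hitProb (D + stepDiff s) := by
  rw [← hit_succ_eq_sum, hitProb]
  congr 1
  ext ω
  refine ⟨fun ⟨n, hn⟩ => ?_, fun ⟨n, hn⟩ => ⟨n + 1, hn⟩⟩
  cases n with
  | zero => exact absurd (by simpa [walk, walk'] using hn) hD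
  | succ n => exact ⟨n, hn⟩

/-- The hitting probability is superharmonic. -/
lemma sum_hitProb_le [NeZero d] (D : Fin d → ℤ) :
    ∑ s, hitProb (D + stepDiff s) ≤ (d : ℝ) ^ 2 * hitProb D := by
  have hd : (0 : ℝ) < (d : ℝ) ^ 2 := by have := NeZero.pos d; positivity
  by_cases hD : l1norm D = 2
  · rw [hitProb_of_l1norm_eq hD]
    refine (Finset.sum_le_sum fun s _ => hitProb_le_one (D + stepDiff s)).trans ?_
    simp [sq]
  · rw [hitProb_of_l1norm_ne hD, mul_inv_cancel_left₀ hd.ne']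

lemma l1norm_comp_perm (σ : Equiv.Perm (Fin d)) (x : Fin d → ℤ) : l1norm (x ∘ σ) = l1norm x :=
  Equiv.sum_comp σ fun i => |x i|

lemma l1norm_zero : l1norm (0 : Fin d → ℤ) = 0 := by simp [l1norm]

lemma l1norm_single_sub_single {a b : Fin d} (h : a ≠ b) :
    l1norm (Pi.single a 1 - Pi.single b 1 : Fin d → ℤ) = 2 := by
  have (i : Fin d) : |(Pi.single a 1 - Pi.single b 1 : Fin d → ℤ) i| =
      (Pi.single a 1 : Fin d → ℤ) i + (Pi.single b 1 : Fin d → ℤ) i := by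
    by_cases ha : i = a
    · subst ha; simp [h]
    · by_cases hb : i = b
      · subst hb; simp [ha]
      · simp [ha, hb]
  rw [l1norm, Finset.sum_congr rfl fun i _ => this i]
  simp [Finset.sum_add_distrib]

lemma l1norm_stepDiff {s : Fin d × Fin d} : l1norm (stepDiff s) = 2 ↔ s.1 ≠ s.2 := by
  refine ⟨fun h hs => ?_, l1norm_single_sub_single⟩
  rw [stepDiff, hs, sub_self, l1norm_zero] at h
  norm_num at h

/-- At the origin the difference of the walks stays put with probability `1 / d` and moves to
distance `2` otherwise, so it almost surely reaches distance `2`. -/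
lemma hitProb_zero [NeZero d] (hd : 2 ≤ d) : hitProb (0 : Fin d → ℤ) = 1 := by
  have hd' : (2 : ℝ) ≤ d := by exact_mod_cast hd
  have h := hitProb_of_l1norm_ne (D := (0 : Fin d → ℤ)) (by rw [l1norm_zero]; norm_num)
  have hs (s : Fin d × Fin d) : hitProb (0 + stepDiff s) =
      1 - if s.1 = s.2 then 1 - hitProb (0 : Fin d → ℤ) else 0 := by
    rw [zero_add]
    split_ifs with hs
    · rw [stepDiff, hs, sub_self]; ring
    · rw [hitProb_of_l1norm_eq (l1norm_stepDiff.2 hs), sub_zero]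
  simp only [hs, Finset.sum_sub_distrib, Fintype.sum_prod_type, Finset.sum_ite_eq,
    Finset.mem_univ, if_true, Finset.sum_const, Finset.card_univ, Fintype.card_prod,
    Fintype.card_fin, Nat.cast_mul,
    nsmul_eq_mul, mul_one] at h
  field_simp at h
  have : (hitProb (0 : Fin d → ℤ) - 1) * (d - 1) = 0 := by linarith
  rcases mul_eq_zero.1 this with h0 | h0
  · linarith
  · linarith

/-! ### Symmetry under coordinate permutations -/

/-- Relabelling the coordinates of both walks. -/
def permStep (σ : Equiv.Perm (Fin d)) (ω : Steps d) : Steps d :=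
  fun n => Prod.map σ σ (ω n)

lemma single_comp_perm (σ : Equiv.Perm (Fin d)) (a : Fin d) :
    (Pi.single (σ a) 1 : Fin d → ℤ) ∘ σ = Pi.single a 1 := by
  ext i; simp [Pi.single_apply]

lemma stepDiff_comp_perm (σ : Equiv.Perm (Fin d)) (s : Fin d × Fin d) :
    stepDiff (Prod.map σ σ s) ∘ σ = stepDiff s := by
  simp only [stepDiff, Prod.map_fst, Prod.map_snd, Pi.sub_comp, single_comp_perm]

lemma walk_sub_permStep (σ : Equiv.Perm (Fin d)) (ω : Steps d) (n : ℕ) :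
    (walk (permStep σ ω) n - walk' (permStep σ ω) n) ∘ σ = walk ω n - walk' ω n := by
  simp only [walk, walk', ← Finset.sum_sub_distrib]
  induction n with
  | zero => rfl
  | succ n ih =>
    rw [Finset.sum_range_succ, Finset.sum_range_succ, ← ih, Pi.add_comp]
    congr 1
    exact stepDiff_comp_perm σ (ω n)

lemma map_permStep [NeZero d] (σ : Equiv.Perm (Fin d)) :
    (walkMeasure d).map (permStep σ) = walkMeasure d := by
  have h : (stepLaw d).map (Prod.map σ σ) = stepLaw d := by
    refine Measure.ext_of_singleton fun s => ?_
    rw [Measure.map_apply (measurable_of_countable _) (measurableSet_singleton s),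
      stepLaw_singleton]
    have : Prod.map σ σ ⁻¹' {s} = {((σ.symm s.1, σ.symm s.2) : Fin d × Fin d)} := by
      ext x
      simp [Prod.ext_iff, Equiv.eq_symm_apply]
    rw [this, stepLaw_singleton]
  have := Measure.infinitePi_map_pi (fun _ : ℕ => stepLaw d)
    (f := fun _ => Prod.map σ σ) fun _ => measurable_of_countable _
  simp only [h] at this
  exact this

lemma hitProb_comp_perm [NeZero d] (σ : Equiv.Perm (Fin d)) (D : Fin d → ℤ) :
    hitProb (D ∘ σ) = hitProb D := by
  have hm : Measurable (permStep σ) :=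
    measurable_pi_iff.2 fun n => (measurable_of_countable _).comp (measurable_pi_apply n)
  unfold hitProb
  conv_rhs => rw [← map_permStep σ, map_measureReal_apply hm (measurableSet_hit D)]
  congr 1
  ext ω
  simp only [Set.mem_ofPred_eq, Set.mem_preimage, ← walk_sub_permStep σ ω, ← Pi.add_comp,
    l1norm_comp_perm]

lemma exists_perm_apply_eq {a b a' b' : Fin d} (h : a ≠ b) (h' : a' ≠ b') :
    ∃ σ : Equiv.Perm (Fin d), σ a = a' ∧ σ b = b' := by
  have hx : Equiv.swap a a' b ≠ a' := fun hx =>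
    h ((Equiv.swap a a').injective (by rw [hx, Equiv.swap_apply_left]))
  exact ⟨Equiv.swap (Equiv.swap a a' b) b' * Equiv.swap a a', by
    rw [Equiv.Perm.mul_apply, Equiv.swap_apply_left, Equiv.swap_apply_of_ne_of_ne hx.symm h'], by
    rw [Equiv.Perm.mul_apply, Equiv.swap_apply_left]⟩

/-- By symmetry, the probability of a later visit to distance `2` does not depend on the
starting point `e_a - e_b`. -/
lemma sum_hitProb_stepDiff_eq [NeZero d] {s t : Fin d × Fin d} (hs : s.1 ≠ s.2) (ht : t.1 ≠ t.2) :
    ∑ k, hitProb (stepDiff s + stepDiff k) = ∑ k, hitProb (stepDiff t + stepDiff k) := by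
  obtain ⟨σ, h1, h2⟩ := exists_perm_apply_eq hs ht
  have ht : t = Prod.map σ σ s := Prod.ext h1.symm h2.symm
  rw [← Equiv.sum_comp (Equiv.prodCongr σ σ) fun k => hitProb (stepDiff t + stepDiff k)]
  refine Finset.sum_congr rfl fun k _ => ?_
  rw [← hitProb_comp_perm σ (stepDiff t + _), Pi.add_comp, ht]
  congr 2
  · exact (stepDiff_comp_perm σ s).symm
  · exact (stepDiff_comp_perm σ k).symm

/-- The first-step decomposition of `p₂`, started at any difference `e_a - e_b` with `a ≠ b`. -/
lemma sum_hitProb_stepDiff [NeZero d] {s : Fin d × Fin d} (hs : s.1 ≠ s.2) :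
    ∑ k, hitProb (stepDiff s + stepDiff k) = (d : ℝ) ^ 2 * p₂ d := by
  have hd : (d : ℝ) ≠ 0 := Nat.cast_ne_zero.2 (NeZero.ne d)
  have hA : MeasurableSet {ω : Steps d | l1norm (walk ω 1 - walk' ω 1) = 2} := by
    simpa only [zero_add] using measurableSet_l1norm_walk_sub (0 : Fin d → ℤ) 1
  have hB : MeasurableSet {ω : Steps d | ∃ n : ℕ, 2 ≤ n ∧ l1norm (walk ω n - walk' ω n) = 2} := by
    simp only [Set.ofPred_exists]
    refine .iUnion fun n => .inter (.const _) ?_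
    have := measurableSet_l1norm_walk_sub (0 : Fin d → ℤ) n
    simp only [zero_add] at this
    exact this
  have hfirst (k : Fin d × Fin d) (ω : Steps d) :
      l1norm (walk (consStep k ω) 1 - walk' (consStep k ω) 1) = 2 ↔ k.1 ≠ k.2 := by
    rw [← zero_add 1, walk_sub_consStep_succ]
    simpa [walk, walk'] using l1norm_stepDiff
  have hpA (k : Fin d × Fin d) : (walkMeasure d).real
      (consStep k ⁻¹' {ω : Steps d | l1norm (walk ω 1 - walk' ω 1) = 2}) =
        if k.1 ≠ k.2 then 1 else 0 := by
    simp only [Set.preimage_ofPred_eq, hfirst]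
    split_ifs with h <;> simp [h]
  have hpAB (k : Fin d × Fin d) : (walkMeasure d).real
      (consStep k ⁻¹' ({ω : Steps d | l1norm (walk ω 1 - walk' ω 1) = 2} ∩
        {ω : Steps d | ∃ n : ℕ, 2 ≤ n ∧ l1norm (walk ω n - walk' ω n) = 2})) =
        (((d : ℝ) ^ 2)⁻¹ * ∑ k, hitProb (stepDiff s + stepDiff k)) *
          if k.1 ≠ k.2 then 1 else 0 := by
    split_ifs with h
    · rw [mul_one, sum_hitProb_stepDiff_eq hs h, ← hit_succ_eq_sum]
      congr 1
      ext ω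
      simp only [Set.preimage_inter, Set.preimage_ofPred_eq, hfirst, Set.mem_inter_iff,
        Set.mem_ofPred_eq, h, true_and, not_false_eq_true, ne_eq, ← walk_sub_consStep_succ]
      refine ⟨fun ⟨n, hn, H⟩ => ⟨n - 2, ?_⟩, fun ⟨n, H⟩ => ⟨n + 2, by omega, H⟩⟩
      rwa [show n - 2 + 1 + 1 = n by omega]
    · rw [mul_zero]
      convert measureReal_empty using 2
      ext ω
      simp only [Set.preimage_inter, Set.preimage_ofPred_eq, hfirst, h]
      simp
  rw [p₂, measureReal_def, cond_apply hA, ENNReal.toReal_mul, ENNReal.toReal_inv,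
    ← measureReal_def, ← measureReal_def, walkMeasure_real_eq_sum hA,
    walkMeasure_real_eq_sum (hA.inter hB)]
  simp only [hpA, hpAB, ← Finset.mul_sum]
  have hpos : 0 < ∑ k : Fin d × Fin d, if k.1 ≠ k.2 then (1 : ℝ) else 0 :=
    Finset.sum_pos' (fun k _ => by split_ifs <;> norm_num) ⟨s, Finset.mem_univ _, by simp [hs]⟩
  generalize (∑ k : Fin d × Fin d, if k.1 ≠ k.2 then (1 : ℝ) else 0) = K at hpos
  have := hpos.ne'
  field_simp

/-! ### Edges shared by two paths between consecutive levels -/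

/-- The standard basis vectors of `ℤ^d`. -/
def basisVec (i : Fin d) : Fin d → ℤ := Pi.single i 1

lemma basisVec_injective : Function.Injective (basisVec : Fin d → Fin d → ℤ) := fun i j h => by
  have := congrFun h i
  by_contra hij
  simp [basisVec, hij] at this

lemma stepDiff_eq (s : Fin d × Fin d) : stepDiff s = basisVec s.1 - basisVec s.2 := rfl

/-- A difference of two distinct basis vectors determines both of them. -/
lemma basisVec_sub_eq_iff {a b i j : Fin d} (hab : a ≠ b) :
    basisVec a - basisVec b = basisVec i - basisVec j ↔ a = i ∧ b = j := by
  refine ⟨fun h => ?_, fun ⟨h1, h2⟩ => by rw [h1, h2]⟩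
  have hai : a = i := by
    by_contra hai
    have := congrFun h a
    simp only [basisVec, Pi.sub_apply, Pi.single_eq_same, Pi.single_eq_of_ne hab,
      Pi.single_eq_of_ne hai, sub_zero, zero_sub] at this
    by_cases haj : a = j
    · subst haj
      simp at this
    · simp [haj] at this
  subst hai
  exact ⟨rfl, basisVec_injective (sub_right_injective h)⟩

/-- The edges incident to an oriented path between two consecutive levels, where the path steps
from `x` to `x + e_i`. The pair `(u, j)` stands for the edge from `u` to `u + e_j`. -/
def levelEdges (x : Fin d → ℤ) (i : Fin d) : Finset ((Fin d → ℤ) × Fin d) :=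
  Finset.univ.image (fun j => (x, j)) ∪
    Finset.univ.image fun j => (x + basisVec i - basisVec j, j)

lemma mem_levelEdges {x : Fin d → ℤ} {i : Fin d} {a : (Fin d → ℤ) × Fin d} :
    a ∈ levelEdges x i ↔ a.1 = x ∨ a.1 + basisVec a.2 = x + basisVec i := by
  obtain ⟨u, j⟩ := a
  simp only [levelEdges, Finset.mem_union, Finset.mem_image, Finset.mem_univ, true_and,
    Prod.mk.injEq]
  constructor
  · rintro (⟨k, rfl, rfl⟩ | ⟨k, rfl, rfl⟩) <;> simp
  · rintro (rfl | h)
    · exact .inl ⟨j, rfl, rfl⟩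
    · exact .inr ⟨j, by rw [← h, add_sub_cancel_right], rfl⟩

lemma card_levelEdges_le (x : Fin d → ℤ) (i : Fin d) : (levelEdges x i).card ≤ 2 * d - 1 := by
  have hsub : levelEdges x i ⊆ Finset.univ.image (fun j => (x, j)) ∪
      (Finset.univ.erase i).image fun j => (x + basisVec i - basisVec j, j) := by
    intro a ha
    rw [mem_levelEdges] at ha
    obtain ⟨u, j⟩ := a
    simp only [Finset.mem_union, Finset.mem_image, Finset.mem_univ, true_and, Prod.mk.injEq,
      Finset.mem_erase, and_true]
    rcases ha with rfl | h
    · exact .inl ⟨j, rfl, rfl⟩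
    · by_cases hj : j = i
      · subst hj
        exact .inl ⟨j, (add_right_cancel h).symm, rfl⟩
      · exact .inr ⟨j, hj, by rw [← h]; exact add_sub_cancel_right _ _, rfl⟩
  refine (Finset.card_le_card hsub).trans ((Finset.card_union_le _ _).trans ?_)
  have h1 := Finset.card_image_le (s := (Finset.univ : Finset (Fin d))) (f := fun j => (x, j))
  have h2 := Finset.card_image_le (s := (Finset.univ : Finset (Fin d)).erase i)
    (f := fun j => (x + basisVec i - basisVec j, j))
  rw [Finset.card_erase_of_mem (Finset.mem_univ i)] at h2
  simp only [Finset.card_univ, Fintype.card_fin] at h1 h2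
  have := i.pos
  omega

/-- After separating from a common vertex, two paths share only the edges going up from it. -/
lemma card_inter_levelEdges_self_le (x : Fin d → ℤ) {i j : Fin d} (hij : i ≠ j) :
    (levelEdges x i ∩ levelEdges x j).card ≤ d := by
  have hsub : levelEdges x i ∩ levelEdges x j ⊆ Finset.univ.image fun k => (x, k) := by
    intro a ha
    rw [Finset.mem_inter, mem_levelEdges, mem_levelEdges] at ha
    have hx : a.1 = x := by
      rcases ha with ⟨h | h, h' | h'⟩
      · exact h
      · exact h
      · exact h'
      · exact absurd (basisVec_injective (add_left_cancel (h.symm.trans h'))) hij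
    exact Finset.mem_image.2 ⟨a.2, Finset.mem_univ _, by rw [← hx]⟩
  exact (Finset.card_le_card hsub).trans (Finset.card_image_le.trans (by simp))

/-- Two paths that meet share only the edges coming from below into the meeting point. -/
lemma card_inter_levelEdges_meet_le {x y : Fin d → ℤ} {i j : Fin d} (hxy : x ≠ y)
    (h : x + basisVec i = y + basisVec j) :
    (levelEdges x i ∩ levelEdges y j).card ≤ d := by
  have hsub : levelEdges x i ∩ levelEdges y j ⊆
      Finset.univ.image fun k => (x + basisVec i - basisVec k, k) := by
    intro a ha
    rw [Finset.mem_inter, mem_levelEdges, mem_levelEdges] at ha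
    have hx : a.1 + basisVec a.2 = x + basisVec i := by
      rcases ha with ⟨h1 | h1, h2 | h2⟩
      · exact absurd (h1.symm.trans h2) hxy
      · exact h2.trans h.symm
      · exact h1
      · exact h1
    exact Finset.mem_image.2 ⟨a.2, Finset.mem_univ _, by rw [← hx, add_sub_cancel_right]⟩
  exact (Finset.card_le_card hsub).trans (Finset.card_image_le.trans (by simp))

/-- An edge shared by two paths that are apart joins a vertex of one path to the next vertex of
the other. -/
lemma eq_or_eq_of_mem_inter_levelEdges {x y : Fin d → ℤ} {i j : Fin d} (hxy : x ≠ y)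
    (h : x + basisVec i ≠ y + basisVec j) {a : (Fin d → ℤ) × Fin d}
    (ha : a ∈ levelEdges x i ∩ levelEdges y j) :
    (a.1 = x ∧ x - y = basisVec j - basisVec a.2) ∨
      (a.1 = y ∧ x - y = basisVec a.2 - basisVec i) := by
  rw [Finset.mem_inter, mem_levelEdges, mem_levelEdges] at ha
  rcases ha with ⟨h1 | h1, h2 | h2⟩
  · exact absurd (h1.symm.trans h2) hxy
  · refine .inl ⟨h1, ?_⟩
    rw [h1] at h2
    rw [sub_eq_sub_iff_add_eq_add, h2, add_comm]
  · refine .inr ⟨h2, ?_⟩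
    rw [h2] at h1
    rw [sub_eq_sub_iff_add_eq_add, ← h1, add_comm]
  · exact absurd (h1.symm.trans h2) h

lemma inter_levelEdges_eq_empty {x y : Fin d → ℤ} (hxy : x ≠ y)
    (h : ∀ a b : Fin d, x - y ≠ basisVec a - basisVec b) (i j : Fin d) :
    levelEdges x i ∩ levelEdges y j = ∅ := by
  refine Finset.eq_empty_of_forall_notMem fun a ha => ?_
  have hne : x + basisVec i ≠ y + basisVec j := fun he =>
    h j i (by rw [sub_eq_sub_iff_add_eq_add, he, add_comm])
  rcases eq_or_eq_of_mem_inter_levelEdges hxy hne ha with ⟨-, h1⟩ | ⟨-, h1⟩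
  · exact h _ _ h1
  · exact h _ _ h1

/-- Near misses: two paths at difference `e_a - e_b` that do not meet in the next step share at
most one edge, and they share none unless the second path steps along `e_a` or the first one
along `e_b`. -/
lemma card_inter_levelEdges_le_ite {x y : Fin d → ℤ} {a b : Fin d} (hab : a ≠ b)
    (hxy : x - y = basisVec a - basisVec b) {i j : Fin d} (hij : ¬(i = b ∧ j = a)) :
    (levelEdges x i ∩ levelEdges y j).card ≤ if i = b ∨ j = a then 1 else 0 := by
  have hne : x ≠ y := fun h => hab (basisVec_injective (by
    rw [← sub_eq_zero, ← hxy, h, sub_self]))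
  have hmeet : x + basisVec i ≠ y + basisVec j := fun h => by
    have h' : x - y = basisVec j - basisVec i := by
      rw [sub_eq_sub_iff_add_eq_add, h, add_comm]
    have := (basisVec_sub_eq_iff hab).1 (hxy.symm.trans h')
    exact hij ⟨this.2.symm, this.1.symm⟩
  have key : ∀ e ∈ levelEdges x i ∩ levelEdges y j,
      (j = a ∧ e = (x, b)) ∨ (i = b ∧ e = (y, a)) := by
    intro e he
    rcases eq_or_eq_of_mem_inter_levelEdges hne hmeet he with ⟨h1, h2⟩ | ⟨h1, h2⟩
    · have := (basisVec_sub_eq_iff hab).1 (hxy.symm.trans h2)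
      exact .inl ⟨this.1.symm, Prod.ext h1 this.2.symm⟩
    · have := (basisVec_sub_eq_iff hab).1 (hxy.symm.trans h2)
      exact .inr ⟨this.2.symm, Prod.ext h1 this.1.symm⟩
  split_ifs with h
  · refine Finset.card_le_one.2 fun e he e' he' => ?_
    rcases key e he with ⟨h1, h2⟩ | ⟨h1, h2⟩ <;> rcases key e' he' with ⟨h3, h4⟩ | ⟨h3, h4⟩
    · rw [h2, h4]
    · exact absurd ⟨h3, h1⟩ hij
    · exact absurd ⟨h1, h3⟩ hij
    · rw [h2, h4]
  · rw [Nat.le_zero, Finset.card_eq_zero]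
    refine Finset.eq_empty_of_forall_notMem fun e he => h ?_
    rcases key e he with h1 | h1
    · exact .inr h1.1
    · exact .inl h1.1

/-! ### The superharmonic potential -/

/-- The function of the difference `D` of the two walks that dominates the expected weight of the
shared edges: `H` at the origin, and affine in the hitting probability elsewhere. -/
noncomputable def potential (H c : ℝ) (D : Fin d → ℤ) : ℝ :=
  if D = 0 then H else 1 + c * hitProb D

lemma potential_zero (H c : ℝ) : potential H c (0 : Fin d → ℤ) = H := if_pos rfl

lemma potential_of_ne {H c : ℝ} {D : Fin d → ℤ} (hD : D ≠ 0) :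
    potential H c D = 1 + c * hitProb D := if_neg hD

lemma stepDiff_ne_zero {s : Fin d × Fin d} (hs : s.1 ≠ s.2) : stepDiff s ≠ 0 := fun h =>
  hs (basisVec_injective (sub_eq_zero.1 h))

lemma sum_ite_diag (A B : ℝ) :
    ∑ s : Fin d × Fin d, (if s.1 = s.2 then A else B) = d * A + d * (d - 1) * B := by
  have (s : Fin d × Fin d) :
      (if s.1 = s.2 then A else B) = B + if s.1 = s.2 then A - B else 0 := by
    split_ifs <;> ring
  simp only [this, Finset.sum_add_distrib, Fintype.sum_prod_type, Finset.sum_ite_eq,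
    Finset.mem_univ, if_true, Finset.sum_const, Finset.card_univ, Fintype.card_prod,
    Fintype.card_fin, nsmul_eq_mul, Nat.cast_mul]
  ring

/-- The potential is superharmonic for the walk weighted by the shared edges. The hypotheses on
`H` and `c` are the inequalities at the origin and at the points `e_a - e_b`. -/
lemma sum_pow_mul_potential_le [NeZero d] (hd : 2 ≤ d) {r H c : ℝ} (hr : 1 ≤ r) (hc : 0 ≤ c)
    (hH : 0 ≤ H)
    (h₀ : d * (r ^ (2 * d - 1) * H) + d * (d - 1) * (r ^ d * (1 + c)) ≤ (d : ℝ) ^ 2 * H)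
    (h₂ : r ^ d * H + (d : ℝ) ^ 2 + r * (1 + c) * ((d : ℝ) ^ 2 * p₂ d - 1) ≤
      (d : ℝ) ^ 2 * (1 + c)) (x y : Fin d → ℤ) :
    ∑ s : Fin d × Fin d, r ^ (levelEdges x s.1 ∩ levelEdges y s.2).card *
      potential H c (x - y + stepDiff s) ≤ (d : ℝ) ^ 2 * potential H c (x - y) := by
  have hr0 : 0 ≤ r := zero_le_one.trans hr
  by_cases hxy : x = y
  · subst hxy
    rw [sub_self, potential_zero]
    refine le_trans (Finset.sum_le_sum fun s _ => ?_) ((sum_ite_diag _ _).trans_le h₀)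
    rw [zero_add]
    split_ifs with hs
    · rw [stepDiff, hs, sub_self, potential_zero, Finset.inter_self]
      gcongr
      exact card_levelEdges_le x s.2
    · rw [potential_of_ne (stepDiff_ne_zero hs), hitProb_of_l1norm_eq (l1norm_stepDiff.2 hs),
        mul_one]
      gcongr
      exact card_inter_levelEdges_self_le x hs
  · have hne : x - y ≠ 0 := sub_ne_zero.2 hxy
    rw [potential_of_ne hne]
    by_cases h : ∃ a b, x - y = basisVec a - basisVec b
    · obtain ⟨a, b, hD⟩ := h
      have hab : a ≠ b := fun h => hne (by rw [hD, h, sub_self])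
      have hD' : x - y = stepDiff (a, b) := hD
      have hone : hitProb (x - y) = 1 := by
        rw [hD']; exact hitProb_of_l1norm_eq (l1norm_stepDiff.2 hab)
      have hsum : ∑ s, (r * (1 + c) * hitProb (x - y + stepDiff s) + 1 +
          if s = (b, a) then r ^ d * H - r * (1 + c) else 0) =
          r ^ d * H + (d : ℝ) ^ 2 + r * (1 + c) * ((d : ℝ) ^ 2 * p₂ d - 1) := by
        rw [Finset.sum_add_distrib, Finset.sum_add_distrib, ← Finset.mul_sum, hD',
          sum_hitProb_stepDiff (s := (a, b)) hab, Finset.sum_ite_eq' Finset.univ (b, a)]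
        simp only [Finset.mem_univ, if_true, Finset.sum_const, Finset.card_univ,
          Fintype.card_prod, Fintype.card_fin, nsmul_eq_mul, Nat.cast_mul]
        ring
      rw [hone, mul_one]
      refine le_trans (Finset.sum_le_sum fun s _ => ?_) (hsum.trans_le h₂)
      obtain ⟨i, j⟩ := s
      by_cases hij : i = b ∧ j = a
      · obtain ⟨rfl, rfl⟩ := hij
        have h0 : x - y + stepDiff (i, j) = 0 := by rw [hD, stepDiff_eq]; abel
        have hmeet : x + basisVec i = y + basisVec j := by
          rw [hD] at h0
          rw [add_comm y, ← sub_eq_sub_iff_add_eq_add, hD]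
        rw [h0, potential_zero, hitProb_zero hd, if_pos rfl]
        have : r ^ (levelEdges x i ∩ levelEdges y j).card * H ≤ r ^ d * H := by
          gcongr
          exact card_inter_levelEdges_meet_le hxy hmeet
        linarith
      · have h0 : x - y + stepDiff (i, j) ≠ 0 := fun h0 => by
          rw [hD, stepDiff_eq, add_eq_zero_iff_eq_neg, neg_sub, basisVec_sub_eq_iff hab] at h0
          exact hij ⟨h0.2.symm, h0.1.symm⟩
        have hcard := card_inter_levelEdges_le_ite hab hD hij
        rw [potential_of_ne h0, if_neg (fun h => hij (Prod.ext_iff.1 h)), add_zero]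
        have hu0 := hitProb_nonneg (x - y + stepDiff (i, j))
        split_ifs at hcard with hcase
        · have hu : hitProb (x - y + stepDiff (i, j)) = 1 := by
            refine hitProb_of_l1norm_eq ?_
            rcases hcase with rfl | rfl
            · have : x - y + stepDiff (i, j) = stepDiff (a, j) := by
                simp only [hD, stepDiff_eq]; abel
              rw [this, l1norm_stepDiff]
              exact fun h => hij ⟨rfl, h.symm⟩
            · have : x - y + stepDiff (i, j) = stepDiff (i, b) := by
                simp only [hD, stepDiff_eq]; abel
              rw [this, l1norm_stepDiff]
              exact fun h => hij ⟨h, rfl⟩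
          have hw : r ^ (levelEdges x i ∩ levelEdges y j).card ≤ r := by
            simpa using pow_le_pow_right₀ hr hcard
          rw [hu, mul_one, mul_one]
          have := mul_le_mul_of_nonneg_right hw (by linarith : 0 ≤ 1 + c)
          linarith
        · rw [Nat.le_zero.1 hcard, pow_zero, one_mul]
          have hcr : c ≤ r * (1 + c) := by nlinarith
          have := mul_le_mul_of_nonneg_right hcr hu0
          linarith
    · push Not at h
      have hterm (s : Fin d × Fin d) : r ^ (levelEdges x s.1 ∩ levelEdges y s.2).card *
          potential H c (x - y + stepDiff s) = 1 + c * hitProb (x - y + stepDiff s) := by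
        have h0 : x - y + stepDiff s ≠ 0 := fun h0 => by
          rw [stepDiff_eq, add_eq_zero_iff_eq_neg, neg_sub] at h0
          exact h _ _ h0
        rw [inter_levelEdges_eq_empty hxy h, Finset.card_empty, pow_zero, one_mul,
          potential_of_ne h0]
      simp only [hterm, Finset.sum_add_distrib, ← Finset.mul_sum]
      have := mul_le_mul_of_nonneg_left (sum_hitProb_le (x - y)) hc
      simp only [Finset.sum_const, Finset.card_univ, Fintype.card_prod, Fintype.card_fin,
        nsmul_eq_mul, Nat.cast_mul, mul_one]
      linarith

/-! ### Pairs of oriented paths -/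

/-- The edges incident to the oriented path from `x` with steps `f`, from the level of `x` up to
the level of the endpoint. -/
def pathEdges : (n : ℕ) → (Fin d → ℤ) → (Fin n → Fin d) → Finset ((Fin d → ℤ) × Fin d)
  | 0, _, _ => ∅
  | n + 1, x, f => levelEdges x (f 0) ∪ pathEdges n (x + basisVec (f 0)) (Fin.tail f)

/-- The level of a vertex: the sum of its coordinates. -/
def level (x : Fin d → ℤ) : ℤ := ∑ i, x i

lemma level_add_basisVec (x : Fin d → ℤ) (i : Fin d) : level (x + basisVec i) = level x + 1 := by
  simp [level, basisVec, Finset.sum_add_distrib]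

lemma level_of_mem_levelEdges {x : Fin d → ℤ} {i : Fin d} {a : (Fin d → ℤ) × Fin d}
    (ha : a ∈ levelEdges x i) : level a.1 = level x := by
  rcases mem_levelEdges.1 ha with h | h
  · rw [h]
  · have := congrArg level h
    rw [level_add_basisVec, level_add_basisVec] at this
    linarith

lemma level_le_of_mem_pathEdges {n : ℕ} {x : Fin d → ℤ} {f : Fin n → Fin d}
    {a : (Fin d → ℤ) × Fin d} (ha : a ∈ pathEdges n x f) : level x ≤ level a.1 := by
  induction n generalizing x with
  | zero => simp [pathEdges] at ha
  | succ n ih =>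
    rcases Finset.mem_union.1 ha with h | h
    · exact (level_of_mem_levelEdges h).ge
    · have := ih h
      rw [level_add_basisVec] at this
      linarith

/-- Shared edges of two paths started at the same level are counted level by level. -/
lemma card_inter_pathEdges_succ_le {n : ℕ} {x y : Fin d → ℤ} (hxy : level x = level y)
    (f g : Fin (n + 1) → Fin d) :
    (pathEdges (n + 1) x f ∩ pathEdges (n + 1) y g).card ≤
      (levelEdges x (f 0) ∩ levelEdges y (g 0)).card +
        (pathEdges n (x + basisVec (f 0)) (Fin.tail f) ∩
          pathEdges n (y + basisVec (g 0)) (Fin.tail g)).card := by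
  refine (Finset.card_le_card ?_).trans (Finset.card_union_le _ _)
  intro a ha
  simp only [pathEdges, Finset.mem_inter, Finset.mem_union] at ha ⊢
  rcases ha with ⟨h1 | h1, h2 | h2⟩
  · exact .inl ⟨h1, h2⟩
  · have e1 := level_of_mem_levelEdges h1
    have e2 := level_le_of_mem_pathEdges h2
    rw [level_add_basisVec] at e2
    linarith
  · have e1 := level_of_mem_levelEdges h2
    have e2 := level_le_of_mem_pathEdges h1
    rw [level_add_basisVec] at e2
    linarith
  · exact .inr ⟨h1, h2⟩

lemma sum_fin_succ_pi {M : Type*} [AddCommMonoid M] {n : ℕ} (F : (Fin (n + 1) → Fin d) → M) :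
    ∑ f, F f = ∑ i, ∑ f : Fin n → Fin d, F (Fin.cons i f) := by
  rw [← (Fin.consEquiv fun _ : Fin (n + 1) => Fin d).sum_comp F, Fintype.sum_prod_type]
  rfl

/-- The second moment bound, by induction on the length of the paths: a potential that is
superharmonic for the one-step weights dominates the total weight of all pairs of paths. -/
lemma sum_pow_card_inter_pathEdges_le {r : ℝ} (hr : 1 ≤ r) {h : (Fin d → ℤ) → ℝ}
    (h_one : ∀ D, 1 ≤ h D)
    (h_super : ∀ x y : Fin d → ℤ, ∑ s : Fin d × Fin d,
      r ^ (levelEdges x s.1 ∩ levelEdges y s.2).card * h (x - y + stepDiff s) ≤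
        (d : ℝ) ^ 2 * h (x - y))
    (n : ℕ) {x y : Fin d → ℤ} (hxy : level x = level y) :
    ∑ f : Fin n → Fin d, ∑ g : Fin n → Fin d, r ^ (pathEdges n x f ∩ pathEdges n y g).card ≤
      ((d : ℝ) ^ 2) ^ n * h (x - y) := by
  have hr0 : 0 ≤ r := zero_le_one.trans hr
  induction n generalizing x y with
  | zero => simpa [pathEdges] using h_one (x - y)
  | succ n ih =>
    calc ∑ f : Fin (n + 1) → Fin d, ∑ g : Fin (n + 1) → Fin d,
          r ^ (pathEdges (n + 1) x f ∩ pathEdges (n + 1) y g).card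
        ≤ ∑ f : Fin (n + 1) → Fin d, ∑ g : Fin (n + 1) → Fin d,
          r ^ (levelEdges x (f 0) ∩ levelEdges y (g 0)).card *
            r ^ (pathEdges n (x + basisVec (f 0)) (Fin.tail f) ∩
              pathEdges n (y + basisVec (g 0)) (Fin.tail g)).card := by
          refine Finset.sum_le_sum fun f _ => Finset.sum_le_sum fun g _ => ?_
          rw [← pow_add]
          exact pow_le_pow_right₀ hr (card_inter_pathEdges_succ_le hxy f g)
      _ = ∑ s : Fin d × Fin d, r ^ (levelEdges x s.1 ∩ levelEdges y s.2).card *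
            ∑ f : Fin n → Fin d, ∑ g : Fin n → Fin d,
              r ^ (pathEdges n (x + basisVec s.1) f ∩ pathEdges n (y + basisVec s.2) g).card := by
          rw [Fintype.sum_prod_type, sum_fin_succ_pi]
          refine Finset.sum_congr rfl fun i _ => ?_
          simp only [sum_fin_succ_pi (n := n), Fin.cons_zero, Fin.tail_cons, Finset.mul_sum]
          exact Finset.sum_comm
      _ ≤ ∑ s : Fin d × Fin d, r ^ (levelEdges x s.1 ∩ levelEdges y s.2).card *
            (((d : ℝ) ^ 2) ^ n * h (x - y + stepDiff s)) := by
          refine Finset.sum_le_sum fun s _ => mul_le_mul_of_nonneg_left ?_ (pow_nonneg hr0 _)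
          have hlev : level (x + basisVec s.1) = level (y + basisVec s.2) := by
            rw [level_add_basisVec, level_add_basisVec, hxy]
          have hd : x - y + stepDiff s = x + basisVec s.1 - (y + basisVec s.2) := by
            rw [stepDiff_eq]; abel
          rw [hd]
          exact ih hlev
      _ = ((d : ℝ) ^ 2) ^ n * ∑ s : Fin d × Fin d,
            r ^ (levelEdges x s.1 ∩ levelEdges y s.2).card * h (x - y + stepDiff s) := by
          rw [Finset.mul_sum]
          exact Finset.sum_congr rfl fun s _ => by ring
      _ ≤ ((d : ℝ) ^ 2) ^ n * ((d : ℝ) ^ 2 * h (x - y)) :=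
          mul_le_mul_of_nonneg_left (h_super x y) (by positivity)
      _ = ((d : ℝ) ^ 2) ^ (n + 1) * h (x - y) := by ring

/-! ### The second moment method -/

/-- The second moment method: the Cauchy–Schwarz inequality for a weighted count of events. -/
lemma sq_sum_measureReal_le {Ω ι : Type*} [MeasurableSpace Ω] [Fintype ι] (μ : Measure Ω)
    [IsProbabilityMeasure μ] {A : ι → Set Ω} (hA : ∀ i, MeasurableSet (A i)) (w : ι → ℝ) :
    (∑ i, w i * μ.real (A i)) ^ 2 ≤
      (∑ i, ∑ j, w i * w j * μ.real (A i ∩ A j)) * μ.real (⋃ i, A i) := by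
  have hU : MeasurableSet (⋃ i, A i) := .iUnion hA
  have hint {s : Set Ω} (hs : MeasurableSet s) : Integrable (s.indicator (1 : Ω → ℝ)) μ :=
    (integrable_const (1 : ℝ)).indicator hs
  have hval {s : Set Ω} (hs : MeasurableSet s) : ∫ ω, s.indicator (1 : Ω → ℝ) ω ∂μ = μ.real s :=
    integral_indicator_one hs
  have key (t : ℝ) : 0 ≤ μ.real (⋃ i, A i) * (t * t) + (-2 * ∑ i, w i * μ.real (A i)) * t +
      ∑ i, ∑ j, w i * w j * μ.real (A i ∩ A j) := by
    have hpt (ω : Ω) : (∑ i, w i * (A i).indicator (1 : Ω → ℝ) ω -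
          t * (⋃ i, A i).indicator (1 : Ω → ℝ) ω) ^ 2 =
        (t * t) * (⋃ i, A i).indicator (1 : Ω → ℝ) ω +
          (-2 * t) * ∑ i, w i * (A i).indicator (1 : Ω → ℝ) ω +
          ∑ i, ∑ j, w i * w j * (A i ∩ A j).indicator (1 : Ω → ℝ) ω := by
      have h1 : (∑ i, w i * (A i).indicator (1 : Ω → ℝ) ω) ^ 2 =
          ∑ i, ∑ j, w i * w j * (A i ∩ A j).indicator (1 : Ω → ℝ) ω := by
        rw [sq, Finset.sum_mul_sum]
        refine Finset.sum_congr rfl fun i _ => Finset.sum_congr rfl fun j _ => ?_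
        rw [Set.inter_indicator_one, Pi.mul_apply]
        ring
      by_cases hω : ω ∈ ⋃ i, A i
      · rw [Set.indicator_of_mem hω, ← h1, Pi.one_apply]
        ring
      · have h0 (i : ι) : (A i).indicator (1 : Ω → ℝ) ω = 0 :=
          Set.indicator_of_notMem (fun hi => hω (Set.mem_iUnion.2 ⟨i, hi⟩)) _
        rw [Set.indicator_of_notMem hω, ← h1]
        simp [h0]
    have hnn : 0 ≤ ∫ ω, (∑ i, w i * (A i).indicator (1 : Ω → ℝ) ω -
          t * (⋃ i, A i).indicator (1 : Ω → ℝ) ω) ^ 2 ∂μ :=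
      integral_nonneg fun ω => sq_nonneg _
    have i1 : Integrable (fun ω => ∑ i, w i * (A i).indicator (1 : Ω → ℝ) ω) μ :=
      integrable_finsetSum _ fun i _ => (hint (hA i)).const_mul _
    have i2 : Integrable (fun ω => ∑ i, ∑ j, w i * w j * (A i ∩ A j).indicator (1 : Ω → ℝ) ω) μ :=
      integrable_finsetSum _ fun i _ => integrable_finsetSum _ fun j _ =>
        (hint ((hA i).inter (hA j))).const_mul _
    have e1 : ∫ ω, ∑ i, w i * (A i).indicator (1 : Ω → ℝ) ω ∂μ = ∑ i, w i * μ.real (A i) := by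
      rw [integral_finsetSum _ fun i _ => (hint (hA i)).const_mul _]
      exact Finset.sum_congr rfl fun i _ => by rw [integral_const_mul, hval (hA i)]
    have e2 : ∫ ω, ∑ i, ∑ j, w i * w j * (A i ∩ A j).indicator (1 : Ω → ℝ) ω ∂μ =
        ∑ i, ∑ j, w i * w j * μ.real (A i ∩ A j) := by
      rw [integral_finsetSum _ fun i _ => integrable_finsetSum _ fun j _ =>
        (hint ((hA i).inter (hA j))).const_mul _]
      refine Finset.sum_congr rfl fun i _ => ?_
      rw [integral_finsetSum _ fun j _ => (hint ((hA i).inter (hA j))).const_mul _]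
      exact Finset.sum_congr rfl fun j _ => by
        rw [integral_const_mul, hval ((hA i).inter (hA j))]
    simp only [hpt] at hnn
    have i3 : Integrable (fun ω => (t * t) * (⋃ i, A i).indicator (1 : Ω → ℝ) ω) μ :=
      (hint hU).const_mul _
    have i4 : Integrable
        (fun ω => (-2 * t) * ∑ i, w i * (A i).indicator (1 : Ω → ℝ) ω) μ := i1.const_mul _
    have i5 : Integrable (fun ω => (t * t) * (⋃ i, A i).indicator (1 : Ω → ℝ) ω +
        (-2 * t) * ∑ i, w i * (A i).indicator (1 : Ω → ℝ) ω) μ := i3.add i4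
    rw [integral_add i5 i2, integral_add i3 i4, integral_const_mul,
      integral_const_mul, hval hU, e1, e2] at hnn
    linarith
  have := discrim_le_zero key
  rw [discrim] at this
  linarith

/-! ### Closed oriented paths -/

/-- The edge of the lattice that the pair `(u, j)` stands for, from `u` to `u + e_j`. -/
def toEdge (a : (Fin d → ℤ) × Fin d) : (latticeGraph d).edgeSet :=
  ⟨s(a.1, a.1 + basisVec a.2), by
    have : l1norm (a.1 - (a.1 + basisVec a.2)) = 1 := by
      simp [l1norm, basisVec, Pi.single_apply, apply_ite abs]
    exact this⟩

lemma toEdge_injective : Function.Injective (toEdge : (Fin d → ℤ) × Fin d → _) := by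
  rintro ⟨u, i⟩ ⟨v, j⟩ h
  rcases Sym2.eq_iff.1 (congrArg Subtype.val h) with ⟨h1, h2⟩ | ⟨h1, h2⟩
  · have h1 : u = v := h1
    subst h1
    have h2 : u + basisVec i = u + basisVec j := h2
    rw [basisVec_injective (add_left_cancel h2)]
  · have e1 := congrArg level h1
    have e2 := congrArg level h2
    simp only [level_add_basisVec] at e1 e2
    linarith

lemma measure_forall_closed (p : unitInterval) (F : Finset ((Fin d → ℤ) × Fin d)) :
    (percolationMeasure d p).real {ω | ∀ a ∈ F, ω (toEdge a) = false} =
      (1 - (p : ℝ)) ^ F.card := by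
  classical
  have : {ω : Config d | ∀ a ∈ F, ω (toEdge a) = false} =
      Set.pi (F.image toEdge : Finset _) fun _ => {false} := by
    ext ω
    simp only [Set.mem_ofPred_eq, Set.mem_pi, Finset.mem_coe, Finset.forall_mem_image,
      Set.mem_singleton_iff]
  rw [this, measureReal_def, percolationMeasure,
    Measure.infinitePi_pi _ fun _ _ => measurableSet_singleton _, ENNReal.toReal_prod]
  simp [Finset.card_image_of_injective _ toEdge_injective]

lemma measurableSet_forall_closed (F : Finset ((Fin d → ℤ) × Fin d)) :
    MeasurableSet {ω : Config d | ∀ a ∈ F, ω (toEdge a) = false} := by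
  simp only [Set.ofPred_forall]
  have h (a : (Fin d → ℤ) × Fin d) : Measurable fun ω : Config d => ω (toEdge a) :=
    measurable_pi_apply (toEdge a)
  exact .biInter F.countable_toSet fun a _ => h a (measurableSet_singleton false)

instance (p : unitInterval) : IsProbabilityMeasure (percolationMeasure d p) := by
  unfold percolationMeasure; infer_instance

/-- There is an oriented path of length `n` from the origin such that all the edges incident to it
between the levels of its two endpoints are closed. All its vertices except the two endpoints are
then shielded. -/
def HasClosedPath (n : ℕ) (ω : Config d) : Prop :=
  ∃ f : Fin n → Fin d, ∀ a ∈ pathEdges n 0 f, ω (toEdge a) = false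

/-- If the weighted count of pairs of paths stays bounded relative to its mean, then closed
oriented paths of every length exist with a probability bounded away from zero. -/
lemma inv_le_measure_hasClosedPath [NeZero d] {p : unitInterval} (hp : (p : ℝ) < 1) {C : ℝ}
    (hC : 0 < C) {n : ℕ}
    (h : ∑ f : Fin n → Fin d, ∑ g : Fin n → Fin d,
      ((1 - (p : ℝ))⁻¹) ^ (pathEdges n 0 f ∩ pathEdges n 0 g).card ≤ ((d : ℝ) ^ 2) ^ n * C) :
    C⁻¹ ≤ (percolationMeasure d p).real {ω | HasClosedPath n ω} := by
  have hq : 0 < 1 - (p : ℝ) := by linarith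
  set q := 1 - (p : ℝ) with hqdef
  have hd : (0 : ℝ) < d := by exact_mod_cast NeZero.pos d
  have hU : {ω : Config d | HasClosedPath n ω} =
      ⋃ f, {ω : Config d | ∀ a ∈ pathEdges n 0 f, ω (toEdge a) = false} := by
    ext ω; simp [HasClosedPath]
  -- Each path is weighted by the inverse of the probability that it is closed.
  have key := sq_sum_measureReal_le (percolationMeasure d p)
    (fun f : Fin n → Fin d => measurableSet_forall_closed (pathEdges n 0 f))
    (fun f => (q⁻¹) ^ (pathEdges n 0 f).card)
  rw [← hU] at key
  have h1 : ∑ f : Fin n → Fin d, (q⁻¹) ^ (pathEdges n 0 f).card *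
      (percolationMeasure d p).real {ω | ∀ a ∈ pathEdges n 0 f, ω (toEdge a) = false} =
        (d : ℝ) ^ n := by
    simp only [measure_forall_closed, ← hqdef, ← mul_pow, inv_mul_cancel₀ hq.ne', one_pow]
    simp
  have h2 (f g : Fin n → Fin d) : (q⁻¹) ^ (pathEdges n 0 f).card *
      (q⁻¹) ^ (pathEdges n 0 g).card * (percolationMeasure d p).real
        ({ω | ∀ a ∈ pathEdges n 0 f, ω (toEdge a) = false} ∩
          {ω | ∀ a ∈ pathEdges n 0 g, ω (toEdge a) = false}) =
        (q⁻¹) ^ (pathEdges n 0 f ∩ pathEdges n 0 g).card := by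
    have : ({ω : Config d | ∀ a ∈ pathEdges n 0 f, ω (toEdge a) = false} ∩
        {ω | ∀ a ∈ pathEdges n 0 g, ω (toEdge a) = false}) =
        {ω | ∀ a ∈ pathEdges n 0 f ∪ pathEdges n 0 g, ω (toEdge a) = false} := by
      ext ω
      simp only [Set.mem_inter_iff, Set.mem_ofPred_eq, Finset.mem_union, or_imp, forall_and]
    rw [this, measure_forall_closed, ← hqdef, ← pow_add,
      ← Finset.card_union_add_card_inter, pow_add, mul_right_comm, ← mul_pow,
      inv_mul_cancel₀ hq.ne', one_pow, one_mul]
  simp only [h2] at key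
  rw [h1, ← pow_mul, mul_comm n 2, pow_mul] at key
  have hpos : (0 : ℝ) < ((d : ℝ) ^ 2) ^ n := by positivity
  have h3 : ((d : ℝ) ^ 2) ^ n * 1 ≤
      ((d : ℝ) ^ 2) ^ n * (C * (percolationMeasure d p).real {ω | HasClosedPath n ω}) := by
    rw [mul_one, ← mul_assoc]
    exact key.trans (mul_le_mul_of_nonneg_right h measureReal_nonneg)
  rw [inv_le_iff_one_le_mul₀' hC]
  exact le_of_mul_le_mul_left h3 hpos

/-! ### Infinite paths by compactness -/

/-- The vertices of the oriented path from `x` with steps `f`. -/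
def pathVertex (x : Fin d → ℤ) (f : ℕ → Fin d) : ℕ → Fin d → ℤ
  | 0 => x
  | n + 1 => pathVertex x f n + basisVec (f n)

lemma pathVertex_succ' (x : Fin d → ℤ) (f : ℕ → Fin d) (n : ℕ) :
    pathVertex (x + basisVec (f 0)) (fun k => f (k + 1)) n = pathVertex x f (n + 1) := by
  induction n with
  | zero => rfl
  | succ n ih => rw [pathVertex, ih]; rfl

lemma level_pathVertex (x : Fin d → ℤ) (f : ℕ → Fin d) (n : ℕ) :
    level (pathVertex x f n) = level x + n := by
  induction n with
  | zero => simp [pathVertex]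
  | succ n ih => rw [pathVertex, level_add_basisVec, ih]; push_cast; ring

lemma mem_pathEdges {n : ℕ} {x : Fin d → ℤ} {f : ℕ → Fin d} {a : (Fin d → ℤ) × Fin d} :
    a ∈ pathEdges n x (fun k => f k) ↔ ∃ k < n, a ∈ levelEdges (pathVertex x f k) (f k) := by
  induction n generalizing x f with
  | zero => simp [pathEdges]
  | succ n ih =>
    have htail : Fin.tail (fun k : Fin (n + 1) => f k) = fun k : Fin n => f (k + 1) := by
      ext k; simp [Fin.tail]
    rw [pathEdges, Finset.mem_union, htail, Fin.val_zero, ih (f := fun k => f (k + 1))]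
    simp only [pathVertex_succ']
    constructor
    · rintro (h | ⟨k, hk, h⟩)
      · exact ⟨0, n.succ_pos, h⟩
      · exact ⟨k + 1, by omega, h⟩
    · rintro ⟨k, hk, h⟩
      cases k with
      | zero => exact .inl h
      | succ k => exact .inr ⟨k, by omega, h⟩

lemma hasClosedPath_iff [NeZero d] {n : ℕ} {ω : Config d} :
    HasClosedPath n ω ↔ ∃ f : ℕ → Fin d,
      ∀ k < n, ∀ a ∈ levelEdges (pathVertex 0 f k) (f k), ω (toEdge a) = false := by
  constructor
  · rintro ⟨f, hf⟩
    refine ⟨fun k => if h : k < n then f ⟨k, h⟩ else 0, fun k hk a ha => hf a ?_⟩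
    have := mem_pathEdges.2 ⟨k, hk, ha⟩
    simpa using this
  · rintro ⟨f, hf⟩
    refine ⟨fun k => f k, fun a ha => ?_⟩
    obtain ⟨k, hk, h⟩ := mem_pathEdges.1 ha
    exact hf k hk a h

lemma pathVertex_congr {x : Fin d → ℤ} {f g : ℕ → Fin d} {n : ℕ} (h : ∀ k < n, f k = g k) :
    pathVertex x f n = pathVertex x g n := by
  induction n with
  | zero => rfl
  | succ n ih => rw [pathVertex, pathVertex, ih fun k hk => h k (by omega), h n n.lt_succ_self]

/-- König's lemma, by compactness of the space of infinite step sequences. -/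
lemma exists_forall_closed [NeZero d] {ω : Config d} (h : ∀ n, HasClosedPath n ω) :
    ∃ f : ℕ → Fin d, ∀ k, ∀ a ∈ levelEdges (pathVertex 0 f k) (f k), ω (toEdge a) = false := by
  let K (n : ℕ) : Set (ℕ → Fin d) :=
    {f | ∀ k < n, ∀ a ∈ levelEdges (pathVertex 0 f k) (f k), ω (toEdge a) = false}
  have hclosed (n : ℕ) : IsClosed (K n) := by
    -- Membership in `K n` depends on the first `n` coordinates only.
    have hopen : IsOpen (K n)ᶜ := by
      refine isOpen_iff_mem_nhds.2 fun f hf => ?_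
      have : {g : ℕ → Fin d | ∀ k ∈ Finset.range n, g k = f k} ∈ nhds f := by
        have ho : IsOpen {g : ℕ → Fin d | ∀ k ∈ Finset.range n, g k = f k} := by
          simp only [Set.ofPred_forall]
          have h (k : ℕ) : Continuous fun g : ℕ → Fin d => g k := continuous_apply k
          exact isOpen_biInter_finset fun k _ => (isOpen_discrete {f k}).preimage (h k)
        exact ho.mem_nhds fun k _ => rfl
      refine Filter.mem_of_superset this fun g hg hgK => hf fun k hk a ha => hgK k hk a ?_
      rw [pathVertex_congr (g := f) fun j hj => hg j (Finset.mem_range.2 (hj.trans hk)),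
        hg k (Finset.mem_range.2 hk)]
      exact ha
    exact isOpen_compl_iff.1 hopen
  have hne := IsCompact.nonempty_iInter_of_sequence_nonempty_isCompact_isClosed K
    (fun n f hf k hk => hf k (by omega)) (fun n => hasClosedPath_iff.1 (h n))
    (hclosed 0).isCompact hclosed
  obtain ⟨f, hf⟩ := hne
  exact ⟨f, fun k => Set.mem_iInter.1 hf (k + 1) k k.lt_succ_self⟩

/-- A neighbour of a vertex is obtained by adding or subtracting a basis vector. -/
lemma exists_basisVec_of_adj {x y : Fin d → ℤ} (h : (latticeGraph d).Adj x y) :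
    ∃ j, y = x + basisVec j ∨ x = y + basisVec j := by
  have h : ∑ i, |(x - y) i| = 1 := h
  obtain ⟨j, -, hj⟩ : ∃ j ∈ Finset.univ, |(x - y) j| ≠ 0 :=
    Finset.exists_ne_zero_of_sum_ne_zero (by rw [h]; norm_num)
  have hsplit := Finset.add_sum_erase Finset.univ (fun i => |(x - y) i|) (Finset.mem_univ j)
  have hnn : 0 ≤ ∑ i ∈ Finset.univ.erase j, |(x - y) i| :=
    Finset.sum_nonneg fun i _ => abs_nonneg _
  have hj0 := abs_nonneg ((x - y) j)
  simp only [h] at hsplit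
  have hj1 : |(x - y) j| = 1 := by omega
  have hrest : ∑ i ∈ Finset.univ.erase j, |(x - y) i| = 0 := by omega
  have hz (i : Fin d) (hi : i ≠ j) : x i = y i := by
    have := (Finset.sum_eq_zero_iff_of_nonneg fun i _ => abs_nonneg _).1 hrest i
      (Finset.mem_erase.2 ⟨hi, Finset.mem_univ i⟩)
    exact sub_eq_zero.1 (abs_eq_zero.1 this)
  refine ⟨j, ?_⟩
  rcases (abs_eq zero_le_one).1 hj1 with h1 | h1
  · right
    ext i
    by_cases hi : i = j
    · subst hi
      simp only [Pi.sub_apply] at h1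
      simp [basisVec]; omega
    · simp [basisVec, hi, hz i hi]
  · left
    ext i
    by_cases hi : i = j
    · subst hi
      simp only [Pi.sub_apply] at h1
      simp [basisVec]; omega
    · simp [basisVec, hi, hz i hi]

lemma adj_add_basisVec (x : Fin d → ℤ) (i : Fin d) :
    (latticeGraph d).Adj x (x + basisVec i) := (toEdge (x, i)).2

lemma isShielded_of_forall {ω : Config d} {x : Fin d → ℤ}
    (h : ∀ a : (Fin d → ℤ) × Fin d, a.1 = x ∨ a.1 + basisVec a.2 = x → ω (toEdge a) = false) :
    IsShielded ω x := by
  rintro ⟨e, he⟩ hx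
  obtain ⟨y, rfl⟩ := Sym2.mem_iff_exists.1 hx
  obtain ⟨j, hj⟩ := exists_basisVec_of_adj (x := x) (y := y) he
  obtain rfl | rfl := hj
  · exact h (x, j) (.inl rfl)
  · have := h (y, j) (.inr rfl)
    rwa [show toEdge (y, j) = ⟨s(y + basisVec j, y), he⟩ from Subtype.ext Sym2.eq_swap] at this

/-- An infinite oriented path whose incident edges above the level of its starting point are closed
is shielded after that point. -/
lemma hasInfiniteShieldedPath_of_forall [NeZero d] {ω : Config d} (h : ∀ n, HasClosedPath n ω) :
    HasInfiniteShieldedPath ω := by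
  obtain ⟨f, hf⟩ := exists_forall_closed h
  refine ⟨fun n => pathVertex 0 f (n + 1), fun m n hmn => ?_, fun n => adj_add_basisVec _ _,
    fun n => isShielded_of_forall ?_⟩
  · have := congrArg level hmn
    simp only [level_pathVertex] at this
    omega
  · rintro a (ha | ha)
    · exact hf (n + 1) a (mem_levelEdges.2 (.inl ha))
    · exact hf n a (mem_levelEdges.2 (.inr ha))

lemma HasClosedPath.of_succ {n : ℕ} [NeZero d] {ω : Config d} (h : HasClosedPath (n + 1) ω) :
    HasClosedPath n ω := by
  rw [hasClosedPath_iff] at h ⊢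
  obtain ⟨f, hf⟩ := h
  exact ⟨f, fun k hk => hf k (by omega)⟩

lemma measure_hasInfiniteShieldedPath_pos [NeZero d] {p : unitInterval} {ε : ℝ} (hε : 0 < ε)
    (h : ∀ n, ε ≤ (percolationMeasure d p).real {ω | HasClosedPath n ω}) :
    0 < percolationMeasure d p {ω | HasInfiniteShieldedPath ω} := by
  have hmeas (n : ℕ) : MeasurableSet {ω : Config d | HasClosedPath n ω} := by
    have : {ω : Config d | HasClosedPath n ω} =
        ⋃ f, {ω : Config d | ∀ a ∈ pathEdges n 0 f, ω (toEdge a) = false} := by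
      ext ω; simp [HasClosedPath]
    rw [this]
    exact .iUnion fun f => measurableSet_forall_closed _
  have hanti : Antitone fun n => {ω : Config d | HasClosedPath n ω} :=
    antitone_nat_of_succ_le fun n ω hω => HasClosedPath.of_succ hω
  have hsub : ⋂ n, {ω : Config d | HasClosedPath n ω} ⊆ {ω | HasInfiniteShieldedPath ω} :=
    fun ω hω => hasInfiniteShieldedPath_of_forall fun n => Set.mem_iInter.1 hω n
  refine lt_of_lt_of_le (ENNReal.ofReal_pos.2 hε) (le_trans ?_ (measure_mono hsub))
  rw [hanti.measure_iInter (fun n => (hmeas n).nullMeasurableSet) ⟨0, measure_ne_top _ _⟩]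
  refine le_iInf fun n => ?_
  rw [ENNReal.ofReal_le_iff_le_toReal (measure_ne_top _ _)]
  exact h n

/-! ### The choice of the constants -/

/-- For `p ≥ 0` the two assumptions provide a potential as in `sum_pow_mul_potential_le`, with
`r = 1 / (1 - p)`. -/
lemma exists_potential_constants {d : ℕ} (hd : 2 ≤ d) {q P : ℝ} (hq0 : 0 < q) (hq1 : q ≤ 1)
    (hx : 0 < (d : ℝ) * q ^ (2 * d - 1) - 1)
    (hW : 1 / q * (P - 1 / (d : ℝ) ^ 2
      + 1 / (d : ℝ) * (1 - 1 / (d : ℝ)) * ((d : ℝ) * q ^ (2 * d - 1) - 1)⁻¹) < 1) :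
    ∃ H c : ℝ, 1 ≤ H ∧ 0 ≤ c ∧
      d * ((q⁻¹) ^ (2 * d - 1) * H) + d * (d - 1) * ((q⁻¹) ^ d * (1 + c)) ≤ (d : ℝ) ^ 2 * H ∧
      (q⁻¹) ^ d * H + (d : ℝ) ^ 2 + q⁻¹ * (1 + c) * ((d : ℝ) ^ 2 * P - 1) ≤
        (d : ℝ) ^ 2 * (1 + c) := by
  have hd' : (2 : ℝ) ≤ d := by exact_mod_cast hd
  have hd0 : (0 : ℝ) < d := by linarith
  have hr : 1 ≤ q⁻¹ := (one_le_inv₀ hq0).2 hq1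
  have hR : 1 ≤ (q⁻¹) ^ (2 * d - 1) := one_le_pow₀ hr
  have hrd : 1 ≤ (q⁻¹) ^ d := one_le_pow₀ hr
  have hRq : (q⁻¹) ^ (2 * d - 1) * q ^ (2 * d - 1) = 1 := by
    rw [← mul_pow, inv_mul_cancel₀ hq0.ne', one_pow]
  have hdd : (q⁻¹) ^ d * (q⁻¹) ^ d = q⁻¹ * (q⁻¹) ^ (2 * d - 1) := by
    rw [← pow_add, ← pow_succ']
    congr 1
    omega
  rw [one_div q] at hW
  generalize (q⁻¹) ^ (2 * d - 1) = R at *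
  generalize (q⁻¹) ^ d = T at *
  generalize q⁻¹ = r at *
  generalize q ^ (2 * d - 1) = Q at *
  set x := (d : ℝ) * Q - 1 with hxdef
  set W := r * (P - 1 / (d : ℝ) ^ 2 + 1 / (d : ℝ) * (1 - 1 / (d : ℝ)) * x⁻¹) with hWdef
  have hRx : R * x = d - R := by
    rw [hxdef]; linear_combination (d : ℝ) * hRq
  have hRx0 : 0 < R * x := by positivity
  have hc : 0 < (1 - W)⁻¹ := inv_pos.2 (by linarith)
  refine ⟨(d - 1) * (1 + (1 - W)⁻¹) * T / (R * x), (1 - W)⁻¹, ?_, hc.le, ?_, ?_⟩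
  · rw [one_le_div hRx0, hRx]
    have h1 : (d : ℝ) - 1 ≤ (d - 1) * (1 + (1 - W)⁻¹) :=
      le_mul_of_one_le_right (by linarith) (by linarith)
    have h2 : ((d : ℝ) - 1) * (1 + (1 - W)⁻¹) ≤ (d - 1) * (1 + (1 - W)⁻¹) * T :=
      le_mul_of_one_le_right (by linarith) hrd
    linarith
  · generalize (1 - W)⁻¹ = c at *
    have hH : (d - R) * ((d - 1) * (1 + c) * T / (R * x)) = (d - 1) * (1 + c) * T := by
      rw [← hRx]; field_simp
    refine le_of_eq ?_
    linear_combination (-(d : ℝ)) * hH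
  · have hcW : (1 - W)⁻¹ * (1 - W) = 1 := inv_mul_cancel₀ (by linarith)
    generalize (1 - W)⁻¹ = c at *
    have hTH : T * ((d - 1) * (1 + c) * T / (R * x)) = (d - 1) * (1 + c) * r / x := by
      rw [← mul_div_assoc, show T * ((d - 1) * (1 + c) * T) = R * ((d - 1) * (1 + c) * r) by
        linear_combination ((d : ℝ) - 1) * (1 + c) * hdd]
      exact mul_div_mul_left _ _ (by linarith)
    have hfin : (d - 1) * (1 + c) * r / x + (d : ℝ) ^ 2 + r * (1 + c) * ((d : ℝ) ^ 2 * P - 1) =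
        (d : ℝ) ^ 2 * (1 + (1 + c) * W) := by
      rw [hWdef]
      field_simp
      ring
    rw [hTH, hfin]
    refine mul_le_mul_of_nonneg_left ?_ (by positivity)
    linarith

lemma le_pShield {d : ℕ} {p : ℝ} (hp : p ∈ unitInterval)
    (h : 0 < percolationMeasure d ⟨p, hp⟩ {ω | HasInfiniteShieldedPath ω}) : p ≤ pShield d :=
  le_csSup ⟨1, fun _ ⟨hx, _⟩ => hx.2⟩ ⟨hp, h⟩

lemma pShield_nonneg (d : ℕ) : 0 ≤ pShield d := Real.sSup_nonneg fun _ ⟨hx, _⟩ => hx.1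

end ShieldedPercolation

theorem theorem2 (d : ℕ) (hd : 4 ≤ d) (p : ℝ)
    (hp₁ : p < 1 - (1 / (d : ℝ)) ^ (1 / (2 * (d : ℝ) - 1)))
    (hp₂ : 1 / (1 - p) * (ShieldedPercolation.p₂ d - 1 / (d : ℝ) ^ 2
      + 1 / (d : ℝ) * (1 - 1 / (d : ℝ)) * ((d : ℝ) * (1 - p) ^ (2 * d - 1) - 1)⁻¹) < 1) :
    p ≤ ShieldedPercolation.pShield d := by
  open ShieldedPercolation in
  rcases lt_or_ge p 0 with hp0 | hp0
  · exact hp0.le.trans (pShield_nonneg d)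
  have : NeZero d := ⟨by omega⟩
  have hd0 : (0 : ℝ) < d := by exact_mod_cast NeZero.pos d
  have hbase : 0 ≤ (1 / (d : ℝ)) ^ (1 / (2 * (d : ℝ) - 1)) := by positivity
  have hp1 : p < 1 := by linarith
  have hx : 0 < (d : ℝ) * (1 - p) ^ (2 * d - 1) - 1 := by
    have h := pow_lt_pow_left₀ (show (1 / (d : ℝ)) ^ (1 / (2 * (d : ℝ) - 1)) < 1 - p by linarith)
      hbase (show 2 * d - 1 ≠ 0 by omega)
    have hcast : 1 / (2 * (d : ℝ) - 1) = ((2 * d - 1 : ℕ) : ℝ)⁻¹ := by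
      rw [Nat.cast_sub (by omega)]; push_cast; rw [one_div]
    rw [hcast, Real.rpow_inv_natCast_pow (by positivity) (by omega), div_lt_iff₀ hd0] at h
    linarith
  obtain ⟨H, c, hH, hc, h₀, h₂⟩ := exists_potential_constants (by omega : 2 ≤ d)
    (show 0 < 1 - p by linarith) (by linarith) hx hp₂
  have hr : 1 ≤ (1 - p)⁻¹ := (one_le_inv₀ (by linarith)).2 (by linarith)
  have hone (D : Fin d → ℤ) : 1 ≤ potential H c D := by
    unfold potential
    split_ifs
    · exact hH
    · linarith [mul_nonneg hc (hitProb_nonneg D)]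
  have hp : p ∈ unitInterval := ⟨hp0, hp1.le⟩
  have hHpos : 0 < H := by linarith
  refine le_pShield hp (measure_hasInfiniteShieldedPath_pos (inv_pos.2 hHpos) fun n =>
    inv_le_measure_hasClosedPath (p := ⟨p, hp⟩) hp1 hHpos ?_)
  have := sum_pow_card_inter_pathEdges_le hr hone
    (sum_pow_mul_potential_le (by omega) hr hc hHpos.le h₀ h₂) n
    (rfl : level (0 : Fin d → ℤ) = level 0)
  rwa [sub_zero, potential_zero] at this
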